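/- Let $\Gamma$ be a finitely generated group that is virtually torsion-free (it has a torsion-free subgroup of finite index), inner-amenable (there is a finitely additive probability measure $\mu$ on all subsets of $\Gamma$ with $\mu(gAg^{-1})=\mu(A)$ and $\mu(\{x\})=0$ for all $g,x\in\Gamma$ and $A\subseteq\Gamma$) and non-amenable (there is no left-translation-invariant finitely additive probability measure on all subsets of $\Gamma$). Then there exist an element $g\in\Gamma\setminus\{e\}$ and finitely generated non-amenable subgroups $L\subseteq K\subseteq\Gamma$ such that $$\mathbb{Z}\cong\langle g\rangle\le Z(L)\trianglelefteq L\le_q K\le_q\Gamma,$$ where $Z(L)$ denotes the centre of $L$ and, for a subgroup $H$ of a group $G$, $H\le_q G$ means that $H$ is $q$-normal in $G$: there is a generating set $S$ of $G$ such that $sHs^{-1}\cap H$ is infinite for every $s\in S$. -/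

import Mathlib

/-- A finitely additive probability measure (a *mean*) defined on all subsets of `X`. -/
structure FinAddProb (X : Type*) where
  /-- The value of the measure on a subset; it lies in `[0, 1]` by the laws below. -/
  meas : Set X → ℝ
  nonneg : ∀ A : Set X, 0 ≤ meas A
  meas_univ : meas Set.univ = 1
  meas_union : ∀ A B : Set X, Disjoint A B → meas (A ∪ B) = meas A + meas B

/-- A (discrete) group is amenable if it carries a finitely additive probability measure on all
its subsets that is invariant under left translation. -/
def IsAmenableGroup (G : Type*) [Group G] : Prop :=
  ∃ μ : FinAddProb G, ∀ (g : G) (A : Set G), μ.meas ((fun x => g * x) '' A) = μ.meas A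

/-- A group is inner-amenable if it carries a finitely additive probability measure on all its
subsets that is invariant under conjugation and atomless, i.e. vanishes on all singletons. -/
def IsInnerAmenableGroup (G : Type*) [Group G] : Prop :=
  ∃ μ : FinAddProb G,
    (∀ (g : G) (A : Set G), μ.meas ((fun x => g * x * g⁻¹) '' A) = μ.meas A) ∧
    ∀ x : G, μ.meas {x} = 0

/-- A group is torsion-free if only the identity has finite order. (For non-commutative groups
this is weaker than `IsMulTorsionFree`, which demands uniqueness of roots.) -/
def IsTorsionFreeGroup (G : Type*) [Group G] : Prop :=
  ∀ x : G, IsOfFinOrder x → x = 1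

/-- A group is virtually torsion-free if it has a torsion-free subgroup of finite index. -/
def IsVirtuallyTorsionFreeGroup (G : Type*) [Group G] : Prop :=
  ∃ H : Subgroup G, H.FiniteIndex ∧ IsTorsionFreeGroup H

/-- A subgroup `H` of `G` is `q`-normal if `G` has a generating set `S` such that
`s H s⁻¹ ∩ H` is infinite for every `s ∈ S`. -/
def IsQNormal {G : Type*} [Group G] (H : Subgroup G) : Prop :=
  ∃ S : Set G, Subgroup.closure S = ⊤ ∧
    ∀ s ∈ S, Infinite (H.map (MulAut.conj s).toMonoidHom ⊓ H : Subgroup G)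

/-! The engine is: if `H` is non-amenable, then `H ⊓ C(x)` is non-amenable for `μ`-almost every `x`.
Otherwise invariant means for these intersections, chosen equivariantly under conjugation by `H` and
averaged over `x`, would give an `H`-invariant mean (`meas_hasInvariantMean_centralizer_eq_zero`).

A coset of the torsion-free subgroup has positive measure, so generic elements can be taken distinct
and in that coset; then `y⁻¹ * x` has infinite order. Applying the engine twice yields `x`, `y` with
`C(y) ⊓ C(x)` non-amenable. This group centralises `g = y⁻¹ * x`, and `L` is generated by `g` and
finitely many elements of it or of `C(g)`, enough to be non-amenable.

For generic `u`, `v` and each `s` in `S ∪ {1}`, the conjugates of `u` and `v` by `s` centralise a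
non-amenable, hence infinite, subgroup of `L`. Adjoining them to `L` gives `K`, in which `L` is
`q`-normal. Finally `K ⊓ sKs⁻¹` contains `s * (v⁻¹ * u) * s⁻¹`, of infinite order, so `K` is
`q`-normal in `Γ`. -/

section

open Filter Topology

/-! ### Finitely additive measures and their ultralimits. -/

namespace FinAddProb

variable {X Y : Type*}

theorem meas_empty (μ : FinAddProb X) : μ.meas ∅ = 0 := by
  have h := μ.meas_union ∅ ∅ (Set.disjoint_empty _)
  rw [Set.union_empty] at h
  linarith

theorem meas_mono (μ : FinAddProb X) {A B : Set X} (h : A ⊆ B) : μ.meas A ≤ μ.meas B := by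
  have h1 := μ.meas_union A (B \ A) Set.disjoint_sdiff_right
  rw [Set.union_sdiff_cancel h] at h1
  linarith [μ.nonneg (B \ A)]

theorem meas_le_one (μ : FinAddProb X) (A : Set X) : μ.meas A ≤ 1 :=
  μ.meas_univ ▸ μ.meas_mono (Set.subset_univ A)

theorem meas_union_le (μ : FinAddProb X) (A B : Set X) :
    μ.meas (A ∪ B) ≤ μ.meas A + μ.meas B := by
  have h1 := μ.meas_union A (B \ A) Set.disjoint_sdiff_right
  rw [Set.union_sdiff_self] at h1
  linarith [μ.meas_mono (Set.sdiff_subset : B \ A ⊆ B)]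

theorem meas_union_null (μ : FinAddProb X) {A B : Set X} (hA : μ.meas A = 0)
    (hB : μ.meas B = 0) : μ.meas (A ∪ B) = 0 :=
  le_antisymm (by linarith [μ.meas_union_le A B]) (μ.nonneg _)

theorem meas_null_of_subset (μ : FinAddProb X) {A B : Set X} (h : A ⊆ B)
    (hB : μ.meas B = 0) : μ.meas A = 0 :=
  le_antisymm (hB ▸ μ.meas_mono h) (μ.nonneg _)

theorem meas_biUnion_le {ι : Type*} (μ : FinAddProb X) (s : Finset ι) (A : ι → Set X) :
    μ.meas (⋃ i ∈ s, A i) ≤ ∑ i ∈ s, μ.meas (A i) := by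
  classical
  induction s using Finset.induction_on with
  | empty => simp [μ.meas_empty]
  | insert a s ha ih =>
    rw [Finset.set_biUnion_insert, Finset.sum_insert ha]
    linarith [μ.meas_union_le (A a) (⋃ i ∈ s, A i)]

theorem meas_biUnion {ι : Type*} (μ : FinAddProb X) (s : Finset ι) (A : ι → Set X)
    (hA : ∀ i j, i ≠ j → Disjoint (A i) (A j)) :
    μ.meas (⋃ i ∈ s, A i) = ∑ i ∈ s, μ.meas (A i) := by
  classical
  induction s using Finset.induction_on with
  | empty => simp [μ.meas_empty]
  | insert a s ha ih =>
    rw [Finset.set_biUnion_insert, Finset.sum_insert ha, μ.meas_union, ih]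
    simp only [Set.disjoint_iUnion_right]
    exact fun i hi => hA a i fun h => ha (h ▸ hi)

theorem nonempty_diff_of_pos (μ : FinAddProb X) {A B : Set X} (hA : 0 < μ.meas A)
    (hB : μ.meas B = 0) : (A \ B).Nonempty := by
  rw [Set.nonempty_iff_ne_empty]
  intro h
  have := μ.meas_null_of_subset (Set.sdiff_eq_empty.1 h) hB
  exact hA.ne' this

/-- The push-forward of a mean along a map. -/
def map (f : X → Y) (μ : FinAddProb X) : FinAddProb Y where
  meas A := μ.meas (f ⁻¹' A)
  nonneg _ := μ.nonneg _
  meas_univ := μ.meas_univ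
  meas_union A B h := by
    rw [Set.preimage_union]
    exact μ.meas_union _ _ (h.preimage f)

/-- The mean conditioned on a set of positive measure, as a mean on the subtype. -/
noncomputable def restrict (μ : FinAddProb X) (B : Set X) (hB : 0 < μ.meas B) :
    FinAddProb B where
  meas C := μ.meas (Subtype.val '' C) / μ.meas B
  nonneg _ := div_nonneg (μ.nonneg _) hB.le
  meas_univ := by simp [hB.ne']
  meas_union C D h := by
    rw [Set.image_union, μ.meas_union, add_div]
    exact (Set.disjoint_image_iff Subtype.val_injective).2 h

/-- The uniform mean on a nonempty finite subset. -/
noncomputable def uniform (s : Set X) (hs : s.Finite) (hne : s.Nonempty) : FinAddProb X where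
  meas A := ((A ∩ s).ncard : ℝ) / s.ncard
  nonneg _ := by positivity
  meas_univ := by
    rw [Set.univ_inter, div_self]
    exact_mod_cast ((Set.ncard_pos hs).2 hne).ne'
  meas_union A B h := by
    rw [Set.union_inter_distrib_right, Set.ncard_union_eq
      (h.mono Set.inter_subset_left Set.inter_subset_left)
      (hs.subset Set.inter_subset_right) (hs.subset Set.inter_subset_right)]
    push_cast
    exact add_div _ _ _

theorem exists_tendsto_of_mem_Icc {ι : Type*} (U : Ultrafilter ι) (a : ι → ℝ)
    (ha : ∀ i, a i ∈ Set.Icc (0 : ℝ) 1) :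
    ∃ l, Tendsto a U (𝓝 l) := by
  obtain ⟨l, -, hl⟩ := (isCompact_Icc (a := (0 : ℝ)) (b := 1)).ultrafilter_le_nhds (U.map a)
    (by
      rw [le_principal_iff]
      exact Filter.mem_map.2 (Filter.univ_mem' ha))
  exact ⟨l, hl⟩

theorem exists_ultralimit {ι : Type*} (U : Ultrafilter ι) (m : ι → FinAddProb X) :
    ∃ ν : FinAddProb X, ∀ A, Tendsto (fun i => (m i).meas A) U (𝓝 (ν.meas A)) := by
  choose l hl using fun A => exists_tendsto_of_mem_Icc U (fun i => (m i).meas A)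
    fun i => ⟨(m i).nonneg A, (m i).meas_le_one A⟩
  refine ⟨⟨l, fun A => ge_of_tendsto' (hl A) fun i => (m i).nonneg A, ?_, ?_⟩, hl⟩
  · refine tendsto_nhds_unique (hl _) ?_
    simp only [meas_univ]
    exact tendsto_const_nhds
  · intro A B h
    refine tendsto_nhds_unique (hl _) ?_
    simp only [meas_union _ A B h]
    exact (hl A).add (hl B)

/-! ### Integration against a mean -/

/-- The integral of a finitely valued function against a mean. -/
noncomputable def simpleIntegral (μ : FinAddProb X) (f : X → ℝ) : ℝ :=
  ∑ᶠ v : ℝ, v * μ.meas (f ⁻¹' {v})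

/-- The sum may be taken over any finite labelling `ψ` that determines the function. Labelling by
pairs of values puts two functions on a common partition, which gives additivity and monotonicity.
-/
theorem simpleIntegral_comp {ι : Type*} [Fintype ι] (μ : FinAddProb X) (ψ : X → ι) (u : ι → ℝ) :
    μ.simpleIntegral (fun x => u (ψ x)) = ∑ i, u i * μ.meas (ψ ⁻¹' {i}) := by
  classical
  have hsupp : (Function.support fun v : ℝ => v * μ.meas ((fun x => u (ψ x)) ⁻¹' {v})) ⊆
      ↑(Finset.univ.image u) := by
    intro v hv
    by_contra hn
    apply hv
    have : (fun x => u (ψ x)) ⁻¹' {v} = ∅ := by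
      ext x
      simp only [Set.mem_preimage, Set.mem_singleton_iff, Set.mem_empty_iff_false, iff_false]
      rintro rfl
      exact hn (by simp)
    simp [this, μ.meas_empty]
  rw [simpleIntegral, finsum_eq_sum_of_support_subset _ hsupp,
    ← Finset.sum_fiberwise_of_maps_to (s := Finset.univ) (t := Finset.univ.image u) (g := u)
      (fun i _ => Finset.mem_image_of_mem u (Finset.mem_univ i))]
  refine Finset.sum_congr rfl fun v _ => ?_
  have : (fun x => u (ψ x)) ⁻¹' {v} = ⋃ i ∈ Finset.univ.filter (fun i => u i = v), ψ ⁻¹' {i} := by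
    ext x
    simp
  rw [this, μ.meas_biUnion, Finset.mul_sum]
  · refine Finset.sum_congr rfl fun i hi => ?_
    rw [(Finset.mem_filter.1 hi).2]
  · intro i j hij
    exact Disjoint.preimage ψ (Set.disjoint_singleton.2 hij)

theorem simpleIntegral_add (μ : FinAddProb X) {f g : X → ℝ} (hf : (Set.range f).Finite)
    (hg : (Set.range g).Finite) :
    μ.simpleIntegral (fun x => f x + g x) = μ.simpleIntegral f + μ.simpleIntegral g := by
  have := hf.fintype
  have := hg.fintype
  let ψ : X → Set.range f × Set.range g := fun x => (⟨f x, x, rfl⟩, ⟨g x, x, rfl⟩)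
  have h1 := μ.simpleIntegral_comp ψ fun i => (i.1 : ℝ)
  have h2 := μ.simpleIntegral_comp ψ fun i => (i.2 : ℝ)
  have h3 := μ.simpleIntegral_comp ψ fun i => (i.1 : ℝ) + i.2
  simp only [add_mul, Finset.sum_add_distrib] at h3
  rw [← h1, ← h2] at h3
  exact h3

theorem simpleIntegral_mono (μ : FinAddProb X) {f g : X → ℝ} (hf : (Set.range f).Finite)
    (hg : (Set.range g).Finite) (h : ∀ x, f x ≤ g x) :
    μ.simpleIntegral f ≤ μ.simpleIntegral g := by
  have := hf.fintype
  have := hg.fintype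
  let ψ : X → Set.range f × Set.range g := fun x => (⟨f x, x, rfl⟩, ⟨g x, x, rfl⟩)
  have h1 := μ.simpleIntegral_comp ψ fun i => (i.1 : ℝ)
  have h2 := μ.simpleIntegral_comp ψ fun i => (i.2 : ℝ)
  refine h1.le.trans (le_trans (Finset.sum_le_sum fun i _ => ?_) h2.ge)
  rcases (ψ ⁻¹' {i}).eq_empty_or_nonempty with he | ⟨x, rfl⟩
  · simp [he, μ.meas_empty]
  · exact mul_le_mul_of_nonneg_right (h x) (μ.nonneg _)

theorem simpleIntegral_const (μ : FinAddProb X) (c : ℝ) : μ.simpleIntegral (fun _ => c) = c := by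
  have h := μ.simpleIntegral_comp (fun _ => ()) fun _ => c
  simpa [μ.meas_univ] using h

/-- The rounding of `f` down to a multiple of `1 / (n + 1)`. -/
noncomputable def roundDown (n : ℕ) (f : X → ℝ) (x : X) : ℝ :=
  (⌊((n : ℝ) + 1) * f x⌋₊ : ℝ) / ((n : ℝ) + 1)

theorem roundDown_finite_range (n : ℕ) {f : X → ℝ} (hf : ∀ x, f x ∈ Set.Icc (0 : ℝ) 1) :
    (Set.range (roundDown n f)).Finite := by
  refine ((Set.finite_Iic (n + 1)).image fun k : ℕ => (k : ℝ) / ((n : ℝ) + 1)).subset ?_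
  rintro _ ⟨x, rfl⟩
  refine ⟨_, ?_, rfl⟩
  refine Nat.floor_le_of_le ?_
  push_cast
  have := (hf x).2
  have hn : (0 : ℝ) ≤ n := n.cast_nonneg
  nlinarith

theorem roundDown_mem (n : ℕ) {f : X → ℝ} (hf : ∀ x, f x ∈ Set.Icc (0 : ℝ) 1) (x : X) :
    roundDown n f x ∈ Set.Icc (0 : ℝ) 1 ∧ roundDown n f x ≤ f x ∧
      f x ≤ roundDown n f x + 1 / ((n : ℝ) + 1) := by
  have hn : (0 : ℝ) < (n : ℝ) + 1 := by positivity
  have h1 := Nat.floor_le (mul_nonneg hn.le (hf x).1)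
  have h2 := (Nat.lt_floor_add_one (((n : ℝ) + 1) * f x)).le
  have h3 : roundDown n f x ≤ f x := by
    rw [roundDown, div_le_iff₀ hn]
    linarith
  refine ⟨⟨by unfold roundDown; positivity, h3.trans (hf x).2⟩, h3, ?_⟩
  rw [roundDown, ← add_div, le_div_iff₀ hn]
  linarith

/-- Every mean extends to an invariant, normalised, additive integral on `[0, 1]`-valued
functions. -/
theorem exists_integral (μ : FinAddProb X) : ∃ I : (X → ℝ) → ℝ,
    (∀ f, (∀ x, f x ∈ Set.Icc (0 : ℝ) 1) → 0 ≤ I f) ∧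
    I (fun _ => 1) = 1 ∧
    (∀ f g, (∀ x, f x ∈ Set.Icc (0 : ℝ) 1) → (∀ x, g x ∈ Set.Icc (0 : ℝ) 1) →
      (∀ x, f x + g x ∈ Set.Icc (0 : ℝ) 1) → I (fun x => f x + g x) = I f + I g) ∧
    ∀ σ : X → X, (∀ C, μ.meas (σ ⁻¹' C) = μ.meas C) → ∀ f, I (fun x => f (σ x)) = I f := by
  let U : Ultrafilter ℕ := hyperfilter ℕ
  have hU : (U : Filter ℕ) ≤ atTop := Nat.hyperfilter_le_atTop
  let a : (X → ℝ) → ℕ → ℝ := fun f n => μ.simpleIntegral (roundDown n f)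
  have hfin : ∀ c : ℝ, (Set.range fun _ : X => c).Finite := fun c =>
    (Set.finite_singleton c).subset (by rintro _ ⟨_, rfl⟩; rfl)
  have ha0 : ∀ f, (∀ x, f x ∈ Set.Icc (0 : ℝ) 1) → ∀ n, 0 ≤ a f n := fun f hf n =>
    (μ.simpleIntegral_const 0).ge.trans <| μ.simpleIntegral_mono (hfin 0)
      (roundDown_finite_range n hf) fun x => (roundDown_mem n hf x).1.1
  have ha1 : ∀ f, (∀ x, f x ∈ Set.Icc (0 : ℝ) 1) → ∀ n, a f n ≤ 1 := fun f hf n =>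
    (μ.simpleIntegral_mono (roundDown_finite_range n hf) (hfin 1)
      fun x => (roundDown_mem n hf x).1.2).trans (μ.simpleIntegral_const 1).le
  have hlim : ∀ f, (∀ x, f x ∈ Set.Icc (0 : ℝ) 1) →
      Tendsto (a f) U (𝓝 (limUnder (U : Filter ℕ) (a f))) := fun f hf =>
    tendsto_nhds_limUnder (exists_tendsto_of_mem_Icc U _ fun n => ⟨ha0 f hf n, ha1 f hf n⟩)
  refine ⟨fun f => limUnder (U : Filter ℕ) (a f), fun f hf => ge_of_tendsto' (hlim f hf) (ha0 f hf),
    ?_, ?_, ?_⟩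
  · have h1 : ∀ x : X, (fun _ : X => (1 : ℝ)) x ∈ Set.Icc (0 : ℝ) 1 := fun _ => by simp
    refine tendsto_nhds_unique (hlim _ h1) ?_
    have : a (fun _ => 1) = fun _ => 1 := by
      funext n
      have hr : roundDown n (fun _ : X => (1 : ℝ)) = fun _ => 1 := by
        funext x
        have hfl : ⌊(n : ℝ) + 1⌋₊ = n + 1 := by exact_mod_cast Nat.floor_natCast (R := ℝ) (n + 1)
        rw [roundDown, mul_one, hfl]
        push_cast
        exact div_self (by positivity)
      simp only [a, hr, μ.simpleIntegral_const]
    rw [this]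
    exact tendsto_const_nhds
  · intro f g hf hg hfg
    -- Rounding makes additivity fail by at most `2 / (n + 1)`, which vanishes along the
    -- nonprincipal ultrafilter.
    have key : Tendsto (fun n => a (fun x => f x + g x) n - (a f n + a g n)) U (𝓝 0) := by
      have ht : Tendsto (fun n : ℕ => 2 * (1 / ((n : ℝ) + 1))) U (𝓝 0) := by
        simpa using (tendsto_one_div_add_atTop_nhds_zero_nat (𝕜 := ℝ)).const_mul 2 |>.mono_left hU
      have ht' : Tendsto (fun n : ℕ => -(2 * (1 / ((n : ℝ) + 1)))) U (𝓝 0) := by simpa using ht.neg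
      refine tendsto_of_tendsto_of_tendsto_of_le_of_le ht' ht (fun n => ?_) fun n => ?_
      all_goals
        have e1 := roundDown_finite_range n hf
        have e2 := roundDown_finite_range n hg
        have e3 := roundDown_finite_range n hfg
        have e4 : (Set.range fun x => roundDown n f x + roundDown n g x).Finite :=
          (e1.image2 (fun u v : ℝ => u + v) e2).subset
            (by rintro _ ⟨x, rfl⟩; exact ⟨_, ⟨x, rfl⟩, _, ⟨x, rfl⟩, rfl⟩)
        have hs := μ.simpleIntegral_add e1 e2
        have hc := hfin (2 * (1 / ((n : ℝ) + 1)))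
        have hcs := μ.simpleIntegral_const (2 * (1 / ((n : ℝ) + 1)))
        have hpos : (0 : ℝ) ≤ 1 / ((n : ℝ) + 1) := by positivity
        simp only [a]
      · have e5 : (Set.range fun x => roundDown n (fun x => f x + g x) x +
            2 * (1 / ((n : ℝ) + 1))).Finite :=
          (e3.image fun u => u + 2 * (1 / ((n : ℝ) + 1))).subset
            (by rintro _ ⟨x, rfl⟩; exact ⟨_, ⟨x, rfl⟩, rfl⟩)
        have hm := μ.simpleIntegral_mono e4 e5 fun x => by
          linarith [(roundDown_mem n hf x).2.1, (roundDown_mem n hg x).2.1,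
            (roundDown_mem n hfg x).2.2]
        have hs' := μ.simpleIntegral_add e3 hc
        linarith
      · have e5 : (Set.range fun x => (roundDown n f x + roundDown n g x) +
            2 * (1 / ((n : ℝ) + 1))).Finite :=
          (e4.image fun u => u + 2 * (1 / ((n : ℝ) + 1))).subset
            (by rintro _ ⟨x, rfl⟩; exact ⟨_, ⟨x, rfl⟩, rfl⟩)
        have hm := μ.simpleIntegral_mono e3 e5 fun x => by
          linarith [(roundDown_mem n hf x).2.2, (roundDown_mem n hg x).2.2,
            (roundDown_mem n hfg x).2.1]
        have hs' := μ.simpleIntegral_add e4 hc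
        linarith
    have := tendsto_nhds_unique key ((hlim _ hfg).sub ((hlim f hf).add (hlim g hg)))
    simp only
    linarith
  · intro σ hσ f
    -- Rounding commutes with composition by `σ`, so the approximating sequences coincide exactly;
    -- convergence is not needed, and `f` is arbitrary.
    have : a (fun x => f (σ x)) = a f := by
      funext n
      simp only [a, simpleIntegral]
      refine finsum_congr fun v => ?_
      rw [← hσ (roundDown n f ⁻¹' {v})]
      rfl
    simp only [this]

/-- The barycentre of a family of means with respect to a mean on the parameter space. -/
theorem exists_barycentre (μ : FinAddProb X) (Φ : X → FinAddProb Y) : ∃ ν : FinAddProb Y,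
    ∀ σ : X → X, (∀ C, μ.meas (σ ⁻¹' C) = μ.meas C) → ∀ A B : Set Y,
      (∀ x, (Φ (σ x)).meas A = (Φ x).meas B) → ν.meas B = ν.meas A := by
  obtain ⟨I, h0, h1, hadd, hinv⟩ := μ.exists_integral
  have hΦ : ∀ A x, (Φ x).meas A ∈ Set.Icc (0 : ℝ) 1 := fun A x =>
    ⟨(Φ x).nonneg A, (Φ x).meas_le_one A⟩
  refine ⟨⟨fun A => I fun x => (Φ x).meas A, fun A => h0 _ (hΦ A), ?_, ?_⟩, ?_⟩
  · simpa only [meas_univ] using h1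
  · intro A B h
    have e : ∀ x, (Φ x).meas (A ∪ B) = (Φ x).meas A + (Φ x).meas B := fun x =>
      (Φ x).meas_union A B h
    simp only [e]
    exact hadd _ _ (hΦ A) (hΦ B) fun x => e x ▸ hΦ _ x
  · intro σ hσ A B h
    have := hinv σ hσ fun x => (Φ x).meas A
    simpa only [h] using this

end FinAddProb

/-! ### Subgroups admitting an invariant mean on the ambient group -/

variable {Γ : Type*} [Group Γ]

/-- There is a mean on the ambient group invariant under left translation by `H`. -/
def HasInvariantMean (H : Subgroup Γ) : Prop :=
  ∃ m : FinAddProb Γ, ∀ h ∈ H, ∀ A : Set Γ, m.meas ((fun x => h * x) ⁻¹' A) = m.meas A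

theorem HasInvariantMean.mono {H K : Subgroup Γ} (h : H ≤ K) :
    HasInvariantMean K → HasInvariantMean H :=
  fun ⟨m, hm⟩ => ⟨m, fun k hk => hm k (h hk)⟩

theorem preimage_mul_left_eq_image (g : Γ) (A : Set Γ) :
    (fun x => g * x) ⁻¹' A = (fun x => g⁻¹ * x) '' A := by
  ext x
  simp only [Set.mem_preimage, Set.mem_image]
  exact ⟨fun h => ⟨_, h, by group⟩, by rintro ⟨y, hy, rfl⟩; simpa using hy⟩

theorem HasInvariantMean.isAmenableGroup (h : HasInvariantMean (⊤ : Subgroup Γ)) :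
    IsAmenableGroup Γ := by
  obtain ⟨m, hm⟩ := h
  refine ⟨m, fun g A => ?_⟩
  rw [← hm g⁻¹ (Subgroup.mem_top _) A, preimage_mul_left_eq_image, inv_inv]

theorem IsAmenableGroup.hasInvariantMean {H : Subgroup Γ} (h : IsAmenableGroup H) :
    HasInvariantMean H := by
  obtain ⟨m, hm⟩ := h
  refine ⟨m.map Subtype.val, fun k hk A => ?_⟩
  rw [FinAddProb.map]
  simp only
  rw [← hm ⟨k, hk⟩⁻¹ (Subtype.val ⁻¹' A), ← preimage_mul_left_eq_image]
  rfl

theorem HasInvariantMean.of_finite {H : Subgroup Γ} (hH : (H : Set Γ).Finite) :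
    HasInvariantMean H := by
  refine ⟨FinAddProb.uniform H hH ⟨1, H.one_mem⟩, fun h hh A => ?_⟩
  have : (fun x => h * x) ⁻¹' A ∩ H = (fun x => h⁻¹ * x) '' (A ∩ H) := by
    rw [← preimage_mul_left_eq_image, Set.preimage_inter]
    congr 1
    ext x
    exact (Subgroup.mul_mem_cancel_left H hh).symm
  simp only [FinAddProb.uniform]
  rw [this, Set.ncard_image_of_injective _ (mul_right_injective _)]

/-- An ultralimit along the directed set of finite subsets works, since each `k ∈ H` eventually lies
in the finite set. The contrapositive supplies finitely generated non-amenable subgroups. -/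
theorem HasInvariantMean.of_closure_finset {H : Subgroup Γ}
    (h : ∀ F : Finset Γ, (F : Set Γ) ⊆ H → HasInvariantMean (Subgroup.closure (F : Set Γ))) :
    HasInvariantMean H := by
  classical
  have h' : ∀ F : Finset H, HasInvariantMean
      (Subgroup.closure ((F.image Subtype.val : Finset Γ) : Set Γ)) := fun F =>
    h _ (by intro x hx; obtain ⟨y, -, rfl⟩ := Finset.mem_image.1 (Finset.mem_coe.1 hx); exact y.2)
  choose m hm using h'
  obtain ⟨ν, hν⟩ := FinAddProb.exists_ultralimit (Ultrafilter.of (atTop : Filter (Finset H))) m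
  refine ⟨ν, fun k hk A => ?_⟩
  refine tendsto_nhds_unique_of_eventuallyEq (hν _) (hν A) ?_
  refine Ultrafilter.of_le (atTop : Filter (Finset H)) ?_
  filter_upwards [eventually_ge_atTop ({⟨k, hk⟩} : Finset H)] with F hF
  exact hm F k (Subgroup.subset_closure
    (Finset.mem_coe.2 (Finset.mem_image.2 ⟨⟨k, hk⟩, hF (Finset.mem_singleton_self _), rfl⟩))) A

/-- Translating an invariant mean of `H ⊓ C(x)` yields one for `H ⊓ C(kxk⁻¹)`. -/
theorem HasInvariantMean.conj {H : Subgroup Γ} {x k : Γ} (hk : k ∈ H)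
    (h : HasInvariantMean (H ⊓ Subgroup.centralizer {x})) :
    HasInvariantMean (H ⊓ Subgroup.centralizer {k * x * k⁻¹}) := by
  obtain ⟨m, hm⟩ := h
  refine ⟨m.map (fun y => k * y), fun l hl A => ?_⟩
  have hl' : k⁻¹ * l * k ∈ H ⊓ Subgroup.centralizer {x} := by
    refine ⟨H.mul_mem (H.mul_mem (H.inv_mem hk) hl.1) hk, ?_⟩
    have := Subgroup.mem_centralizer_singleton_iff.1 hl.2
    refine Subgroup.mem_centralizer_singleton_iff.2 ?_
    calc k⁻¹ * l * k * x = k⁻¹ * (l * (k * x * k⁻¹)) * k := by group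
      _ = k⁻¹ * ((k * x * k⁻¹) * l) * k := by rw [this]
      _ = x * (k⁻¹ * l * k) := by group
  simp only [FinAddProb.map]
  rw [← hm _ hl' ((fun y => k * y) ⁻¹' A)]
  congr 1
  ext y
  simp [mul_assoc]

/-- If `H` has no invariant mean and `μ` is a conjugation-invariant mean, then `H ⊓ C(x)` has no
invariant mean for `μ`-almost every `x`. -/
theorem meas_hasInvariantMean_centralizer_eq_zero {μ : FinAddProb Γ}
    (hμ : ∀ (g : Γ) (A : Set Γ), μ.meas ((fun x => g * x * g⁻¹) '' A) = μ.meas A)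
    {H : Subgroup Γ} (hH : ¬ HasInvariantMean H) :
    μ.meas {x | HasInvariantMean (H ⊓ Subgroup.centralizer {x})} = 0 := by
  by_contra hne
  set B : Set Γ := {x | HasInvariantMean (H ⊓ Subgroup.centralizer {x})} with hB
  have hpos : 0 < μ.meas B := lt_of_le_of_ne (μ.nonneg _) (Ne.symm hne)
  apply hH
  -- Means are chosen only at representatives of `H`-conjugacy classes and translated by `γ x`. The
  -- ambiguity of `γ x` lies in `H ⊓ C(rep x)`, under which the chosen mean is invariant, so the
  -- resulting family is equivariant.
  let r : Setoid B :=
    { r := fun x y => ∃ k ∈ H, k * x.1 * k⁻¹ = y.1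
      iseqv :=
        { refl := fun x => ⟨1, H.one_mem, by simp⟩
          symm := by
            rintro x y ⟨k, hk, h⟩
            exact ⟨k⁻¹, H.inv_mem hk, by rw [← h]; group⟩
          trans := by
            rintro x y z ⟨k, hk, h⟩ ⟨l, hl, h'⟩
            exact ⟨l * k, H.mul_mem hl hk, by rw [← h', ← h]; group⟩ } }
  let rep : B → B := fun x => (Quotient.mk r x).out
  have hrep : ∀ x, ∃ k ∈ H, k * (rep x).1 * k⁻¹ = x.1 := fun x => Quotient.mk_out (s := r) x
  choose γ hγH hγ using hrep
  choose m hm using fun x : B => x.2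
  obtain ⟨ν, hν⟩ := (μ.restrict B hpos).exists_barycentre
    fun x => (m (rep x)).map fun y => γ x * y
  refine ⟨ν, fun k hk A => ?_⟩
  have hmem : ∀ x : B, k * x.1 * k⁻¹ ∈ B := fun x => HasInvariantMean.conj hk x.2
  refine hν (fun x => ⟨k * x.1 * k⁻¹, hmem x⟩) (fun C => ?_) A _ fun x => ?_
  · simp only [FinAddProb.restrict]
    congr 1
    rw [← hμ k⁻¹ (Subtype.val '' C)]
    congr 1
    ext y
    simp only [Set.mem_image, Set.mem_preimage, Subtype.exists, exists_and_right, exists_eq_right,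
      inv_inv]
    constructor
    · rintro ⟨hy, hC⟩
      exact ⟨k * y * k⁻¹, ⟨hmem ⟨y, hy⟩, hC⟩, by group⟩
    · rintro ⟨z, ⟨hz, hC⟩, rfl⟩
      have hz' : k⁻¹ * z * k ∈ B := by
        have := HasInvariantMean.conj (H.inv_mem hk) hz
        rwa [inv_inv] at this
      refine ⟨hz', ?_⟩
      convert hC using 2
      group
  · set x' : B := ⟨k * x.1 * k⁻¹, hmem x⟩
    have hr : rep x' = rep x := by
      have : Quotient.mk r x' = Quotient.mk r x :=
        (Quotient.sound (s := r) (show r x x' from ⟨k, hk, rfl⟩)).symm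
      simp only [rep, this]
    have e1 := hγ x'
    have e2 := hγ x
    rw [hr] at e1
    have hl : (γ x)⁻¹ * k⁻¹ * γ x' ∈ H ⊓ Subgroup.centralizer {(rep x).1} := by
      refine ⟨H.mul_mem (H.mul_mem (H.inv_mem (hγH x)) (H.inv_mem hk)) (hγH x'), ?_⟩
      refine Subgroup.mem_centralizer_singleton_iff.2 ?_
      have e3 : γ x' * (rep x).1 * (γ x')⁻¹ = k * (γ x * (rep x).1 * (γ x)⁻¹) * k⁻¹ := by
        rw [e1, e2]
      calc (γ x)⁻¹ * k⁻¹ * γ x' * (rep x).1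
          = (γ x)⁻¹ * k⁻¹ * (γ x' * (rep x).1 * (γ x')⁻¹) * γ x' := by group
        _ = (rep x).1 * ((γ x)⁻¹ * k⁻¹ * γ x') := by rw [e3]; group
    simp only [FinAddProb.map]
    rw [hr]
    refine Eq.trans ?_ (hm (rep x) _ hl _)
    congr 1
    ext y
    simp [mul_assoc]

/-! ### Construction of the subgroups -/

/-- Finitely many cosets cover a space of measure one. -/
theorem exists_leftCoset_meas_pos (μ : FinAddProb Γ) (H : Subgroup Γ) [H.FiniteIndex] :
    ∃ q : Γ ⧸ H, 0 < μ.meas ((QuotientGroup.mk : Γ → Γ ⧸ H) ⁻¹' {q}) := by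
  by_contra! hcon
  have := H.fintypeQuotientOfFiniteIndex
  have h := μ.meas_biUnion_le Finset.univ fun q : Γ ⧸ H =>
    (QuotientGroup.mk : Γ → Γ ⧸ H) ⁻¹' {q}
  have huniv : (⋃ q ∈ (Finset.univ : Finset (Γ ⧸ H)),
      (QuotientGroup.mk : Γ → Γ ⧸ H) ⁻¹' {q}) = Set.univ := by
    ext x
    simp
  rw [huniv, μ.meas_univ] at h
  linarith [Finset.sum_nonpos fun q (_ : q ∈ (Finset.univ : Finset (Γ ⧸ H))) => hcon q]

theorem not_isOfFinOrder_of_mem {H : Subgroup Γ} (hH : IsTorsionFreeGroup H) {z : Γ} (hz : z ∈ H)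
    (hne : z ≠ 1) : ¬ IsOfFinOrder z := fun h => hne <| by
  have := hH ⟨z, hz⟩ ((H.subtype_injective.isOfFinOrder_iff (x := (⟨z, hz⟩ : H))).1 h)
  exact congrArg Subtype.val this

theorem infinite_of_not_isOfFinOrder_mem {H : Subgroup Γ} {z : Γ} (hz : z ∈ H)
    (hord : ¬ IsOfFinOrder z) : Infinite H := by
  have := (infinite_zpowers (a := z)).2 hord
  exact (this.mono ((Subgroup.zpowers_le (H := H)).2 hz)).to_subtype

end

/-! ### The chain `L ≤ K ≤ Γ`. -/

theorem theorem3p3 (Γ : Type*) [Group Γ] (hfg : Group.FG Γ)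
    (hvtf : IsVirtuallyTorsionFreeGroup Γ) (hinner : IsInnerAmenableGroup Γ)
    (hnon : ¬ IsAmenableGroup Γ) :
    ∃ (g : Γ) (L K : Subgroup Γ),
      g ≠ 1 ∧ L ≤ K ∧
      L.FG ∧ K.FG ∧ ¬ IsAmenableGroup L ∧ ¬ IsAmenableGroup K ∧
      Nonempty (Multiplicative ℤ ≃* Subgroup.zpowers g) ∧
      Subgroup.zpowers g ≤ (Subgroup.center L).map L.subtype ∧
      (Subgroup.center L).Normal ∧
      IsQNormal (L.subgroupOf K) ∧
      IsQNormal K := by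
  classical
  obtain ⟨N, hN, htf⟩ := hvtf
  obtain ⟨μ, hμ, hatom⟩ := hinner
  obtain ⟨S, hS⟩ := Group.fg_def.1 hfg
  obtain ⟨q, hq⟩ := exists_leftCoset_meas_pos μ N
  -- generic pairs in the coset `q` differ by an element of infinite order
  have hpair : ∀ {x y : Γ}, x ∈ (QuotientGroup.mk : Γ → Γ ⧸ N) ⁻¹' {q} →
      y ∈ (QuotientGroup.mk : Γ → Γ ⧸ N) ⁻¹' {q} → x ≠ y → ¬ IsOfFinOrder (y⁻¹ * x) := by
    intro x y hx hy hxy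
    refine not_isOfFinOrder_of_mem htf ?_ fun h => hxy (inv_mul_eq_one.1 h).symm
    exact QuotientGroup.eq.1 ((Set.mem_singleton_iff.1 hy).trans (Set.mem_singleton_iff.1 hx).symm)
  have htop : ¬ HasInvariantMean (⊤ : Subgroup Γ) := fun h => hnon h.isAmenableGroup
  obtain ⟨y, hyq, hy⟩ := μ.nonempty_diff_of_pos hq
    (meas_hasInvariantMean_centralizer_eq_zero hμ htop)
  obtain ⟨x, hxq, hx⟩ := μ.nonempty_diff_of_pos hq
    (μ.meas_union_null (meas_hasInvariantMean_centralizer_eq_zero hμ hy) (hatom y))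
  simp only [Set.mem_union, Set.mem_ofPred_eq, Set.mem_singleton_iff, not_or] at hx
  have hg := hpair hxq hyq hx.2
  set g : Γ := y⁻¹ * x
  obtain ⟨F, hFsub, hF⟩ : ∃ F : Finset Γ, (F : Set Γ) ⊆ Subgroup.centralizer {g} ∧
      ¬ HasInvariantMean (Subgroup.closure (F : Set Γ)) := by
    by_contra! hcon
    refine hx.1 (HasInvariantMean.of_closure_finset fun F hF => hcon F fun z hz => ?_)
    have h1 := Subgroup.mem_centralizer_singleton_iff.1 (hF hz).1.2
    have h2 := Subgroup.mem_centralizer_singleton_iff.1 (hF hz).2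
    exact Subgroup.mem_centralizer_singleton_iff.2
      ((Commute.inv_right (show Commute z y from h1)).mul_right (show Commute z x from h2))
  -- Adjoining `g` to a subset of its centraliser makes it a central element of `L`.
  set L : Subgroup Γ := Subgroup.closure ((insert g F : Finset Γ) : Set Γ) with hLdef
  have hgL : g ∈ L := Subgroup.subset_closure (by simp)
  have hL : ¬ HasInvariantMean L := fun h =>
    hF (h.mono (Subgroup.closure_mono (by simp)))
  have hLcent : L ≤ Subgroup.centralizer {g} := by
    rw [hLdef, Subgroup.closure_le, Finset.coe_insert, Set.insert_subset_iff]
    exact ⟨Subgroup.mem_centralizer_singleton_iff.2 rfl, hFsub⟩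
  -- elements all of whose conjugates by the generators are generic with respect to `L`
  set D : Set Γ := {x | HasInvariantMean (L ⊓ Subgroup.centralizer {x})} with hD
  have hD0 : μ.meas D = 0 := meas_hasInvariantMean_centralizer_eq_zero hμ hL
  -- Including `1` puts `u` and `v` themselves in `K`; hence `v⁻¹ * u ∈ K`, and its conjugate by `s`
  -- lies in `sKs⁻¹`.
  have hE0 : μ.meas (⋃ s ∈ insert 1 S, (fun x => s⁻¹ * x * s⁻¹⁻¹) '' D) = 0 := by
    refine le_antisymm ((μ.meas_biUnion_le _ _).trans ?_) (μ.nonneg _)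
    exact Finset.sum_nonpos fun s _ => by rw [hμ, hD0]
  have hgen : ∀ {z : Γ}, z ∉ (⋃ s ∈ insert 1 S, (fun x => s⁻¹ * x * s⁻¹⁻¹) '' D) →
      ∀ s ∈ insert 1 S, s * z * s⁻¹ ∉ D := by
    intro z hz s hs hzD
    exact hz (Set.mem_biUnion (Finset.mem_coe.2 hs) ⟨_, hzD, by group⟩)
  obtain ⟨v, hvq, hv⟩ := μ.nonempty_diff_of_pos hq hE0
  obtain ⟨u, huq, hu⟩ := μ.nonempty_diff_of_pos hq (μ.meas_union_null hE0 (hatom v))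
  rw [Set.mem_union, not_or] at hu
  have huv := hpair huq hvq fun h => hu.2 h
  set T : Finset Γ := insert g F ∪ ((insert 1 S).image (fun s => s * u * s⁻¹) ∪
    (insert 1 S).image fun s => s * v * s⁻¹) with hT
  set K : Subgroup Γ := Subgroup.closure (T : Set Γ)
  have hLK : L ≤ K := Subgroup.closure_mono (Finset.coe_subset.2 Finset.subset_union_left)
  have huK : ∀ s ∈ insert 1 S, s * u * s⁻¹ ∈ K := fun s hs => Subgroup.subset_closure
    (Finset.mem_coe.2 (Finset.mem_union_right _ (Finset.mem_union_left _
      (Finset.mem_image_of_mem _ hs))))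
  have hvK : ∀ s ∈ insert 1 S, s * v * s⁻¹ ∈ K := fun s hs => Subgroup.subset_closure
    (Finset.mem_coe.2 (Finset.mem_union_right _ (Finset.mem_union_right _
      (Finset.mem_image_of_mem _ hs))))
  have hconjK : ∀ s ∈ insert 1 S, s * (v⁻¹ * u) * s⁻¹ ∈ K := fun s hs => by
    have := K.mul_mem (K.inv_mem (hvK s hs)) (huK s hs)
    convert this using 1
    group
  refine ⟨g, L, K, fun h => hg (h ▸ IsOfFinOrder.one), hLK, ⟨_, rfl⟩, ⟨_, rfl⟩,
    fun h => hL h.hasInvariantMean, fun h => hL (h.hasInvariantMean.mono hLK), ?_, ?_,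
    inferInstance, ?_, ?_⟩
  · have := ((infinite_zpowers (a := g)).2 hg).to_subtype
    exact ⟨intCyclicMulEquiv⟩
  · rw [Subgroup.zpowers_le]
    refine ⟨⟨g, hgL⟩, Subgroup.mem_center_iff.2 fun z => Subtype.ext ?_, rfl⟩
    exact Subgroup.mem_centralizer_singleton_iff.1 (hLcent z.2)
  · refine ⟨(Subtype.val : K → Γ) ⁻¹' T, Subgroup.closure_closure_coe_preimage, ?_⟩
    intro t ht
    -- A non-amenable `M` inside `L ⊓ tLt⁻¹` is infinite. The choice is `M = L` for generators `t ∈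
    -- L`, and `M = L ⊓ C(t)` for the conjugates of `u` and `v`.
    have hinf : ∀ M : Subgroup Γ, M ≤ L → ¬ HasInvariantMean M →
        (∀ z ∈ M, t.1⁻¹ * z * t.1 ∈ L) →
        Infinite ((L.subgroupOf K).map (MulAut.conj t).toMonoidHom ⊓ L.subgroupOf K :
          Subgroup K) := by
      intro M hML hM hMt
      have hMinf : Infinite M := by
        by_contra hfin
        rw [not_infinite_iff_finite] at hfin
        exact hM (HasInvariantMean.of_finite (Set.toFinite _))
      refine Infinite.of_injective (fun z : M => (⟨⟨z.1, hLK (hML z.2)⟩, ?_, hML z.2⟩ :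
        ((L.subgroupOf K).map (MulAut.conj t).toMonoidHom ⊓ L.subgroupOf K : Subgroup K)))
        fun z w h => ?_
      · refine ⟨t⁻¹ * ⟨z.1, hLK (hML z.2)⟩ * t, hMt z.1 z.2, ?_⟩
        simp [mul_assoc]
      · exact Subtype.ext (congrArg (fun k => (k.1.1 : Γ)) h)
    have hcent : t.1 ∉ D → Infinite ((L.subgroupOf K).map (MulAut.conj t).toMonoidHom ⊓
        L.subgroupOf K : Subgroup K) := by
      intro htD
      refine hinf _ inf_le_left htD fun z hz => ?_
      have := Subgroup.mem_centralizer_singleton_iff.1 hz.2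
      rw [mul_assoc, this, inv_mul_cancel_left]
      exact hz.1
    rcases Finset.mem_union.1 (Finset.mem_coe.1 ht) with htL | htuv
    · have htL' : t.1 ∈ L := Subgroup.subset_closure htL
      exact hinf L le_rfl hL fun z hz => L.mul_mem (L.mul_mem (L.inv_mem htL') hz) htL'
    · rcases Finset.mem_union.1 htuv with h | h
      · obtain ⟨s, hs, hst⟩ := Finset.mem_image.1 h
        exact hcent (hst ▸ hgen hu.1 s hs)
      · obtain ⟨s, hs, hst⟩ := Finset.mem_image.1 h
        exact hcent (hst ▸ hgen hv s hs)
  · refine ⟨S, hS, fun s hs => ?_⟩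
    have h1 : v⁻¹ * u ∈ K := by simpa using hconjK 1 (Finset.mem_insert_self _ _)
    have h2 := hconjK s (Finset.mem_insert_of_mem (Finset.mem_coe.1 hs))
    refine infinite_of_not_isOfFinOrder_mem (z := s * (v⁻¹ * u) * s⁻¹) ⟨⟨_, h1, rfl⟩, h2⟩ ?_
    intro h
    exact huv (((MulAut.conj s).injective.isOfFinOrder_iff
      (f := (MulAut.conj s).toMonoidHom) (x := v⁻¹ * u)).1 h)
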